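/- Let $l\ge 1$ be an integer and $\lambda_0>0$. A homogeneous $l$-dimensional shotgun cellular system with density $\lambda_0$ is a system whose base stations are the points of a homogeneous Poisson point process $\Phi$ on $\mathbb{R}^l$ with intensity $\lambda_0$; a mobile station is located at the origin. All transmission powers and shadow fading factors are equal to $1$ and there is no background noise. If the path loss is $1/h(r)$, the mobile station receives power $1/h(|x|)$ from the base station at $x\in\Phi$. It is served by a base station $x_S$ with the strongest received power, all other base stations interfere, and the carrier-to-interference ratio is $$\frac{C}{I}=\frac{1/h(|x_S|)}{\sum_{x\in\Phi,\;x\ne x_S}1/h(|x|)} .$$ For real random variables $X,Y$ (not necessarily defined on the same probability space) write $X\le_{\mathrm{st}}Y$ if $\mathbb{P}(X>t)\le\mathbb{P}(Y>t)$ for all $t\in\mathbb{R}$. Let $\varepsilon_1,\varepsilon_2>l$. Let $(C/I)_1$ and $(C/I)_2$ be the carrier-to-interference ratios in two homogeneous $l$-dimensional shotgun cellular systems with the same density $\lambda_0$, the first with path loss $1/h_1$ and the second with path loss $1/h_2$, where for $r\ge 0$ $$h_1(r)=r^{\varepsilon_1},\qquad h_2(r)=\begin{cases} r^{\varepsilon_1},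 & r\le 1,\\ r^{\varepsilon_2}, & r>1.\end{cases}$$ Then $(C/I)_1$ and $(C/I)_2$ are almost surely well defined, positive and finite random variables, and 1. if $\varepsilon_2>\varepsilon_1>l$, then $(C/I)_1\le_{\mathrm{st}}(C/I)_2$; 2. if $\varepsilon_1>\varepsilon_2>l$, then $(C/I)_2\le_{\mathrm{st}}(C/I)_1$. -/

import Mathlib

open MeasureTheory ProbabilityTheory
open scoped ENNReal

noncomputable section

namespace ShotgunCellular

/-- The location space `ℝ^l` with the Euclidean norm; the mobile station sits at the origin. -/
abbrev Space (l : ℕ) : Type := EuclideanSpace ℝ (Fin l)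

/-- The random set `Φ` of base station locations is a (simple) Poisson point process on `ℝ^l` with
intensity measure `Λ`: it is a random locally finite set whose counts are random variables, the
number of points in a Borel set `A` with `Λ A < ∞` is Poisson distributed with mean `Λ A`, and the
numbers of points in disjoint Borel sets are independent. -/
structure IsPoissonPointProcess {l : ℕ} {Ω : Type*} [MeasurableSpace Ω]
    (Φ : Ω → Set (Space l)) (Λ : Measure (Space l)) (P : Measure Ω) : Prop where
  locallyFinite : ∀ ω, ∀ r : ℝ, (Φ ω ∩ Metric.closedBall 0 r).Finite
  measurable_count : ∀ A : Set (Space l), MeasurableSet A →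
    Measurable fun ω => (Φ ω ∩ A).encard
  law_count : ∀ A : Set (Space l), MeasurableSet A → Λ A < ∞ → ∀ k : ℕ,
    P {ω | (Φ ω ∩ A).encard = k} = poissonMeasure (Λ A).toNNReal {k}
  indep_count : ∀ (n : ℕ) (A : Fin n → Set (Space l)), (∀ i, MeasurableSet (A i)) →
    Pairwise (Function.onFun Disjoint A) →
    iIndepFun (fun (i : Fin n) (ω : Ω) => (Φ ω ∩ A i).encard) P

/-- A homogeneous `l`-dimensional shotgun cellular system with base station density `lam`. -/
def IsHomogeneousSCS {l : ℕ} {Ω : Type*} [MeasurableSpace Ω]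
    (Φ : Ω → Set (Space l)) (lam : ℝ) (P : Measure Ω) : Prop :=
  IsPoissonPointProcess Φ (ENNReal.ofReal lam • volume) P

/-- The power received at the origin from a base station at `x` (transmission power and shadow
fading equal to `1`) when the path loss at distance `r` is `1 / h r`. -/
def receivedPower {l : ℕ} (h : ℝ → ℝ) (x : Space l) : ℝ≥0∞ := (ENNReal.ofReal (h ‖x‖))⁻¹

/-- `x` is a base station of the configuration `φ` with the strongest received power. -/
def IsServing {l : ℕ} (h : ℝ → ℝ) (φ : Set (Space l)) (x : Space l) : Prop :=
  x ∈ φ ∧ ∀ y ∈ φ, receivedPower h y ≤ receivedPower h x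

/-- The total power received from all base stations of `φ` other than `x`. -/
def interference {l : ℕ} (h : ℝ → ℝ) (φ : Set (Space l)) (x : Space l) : ℝ≥0∞ :=
  ∑' y : ↥(φ \ {x}), receivedPower h (y : Space l)

/-- The carrier-to-interference ratio at the origin, as an extended nonnegative number. The supremum
is over the serving base stations, all of which give the same value (see `ratio_eq`); it only
serves to avoid a choice between equally strong base stations. -/
def ratio {l : ℕ} (h : ℝ → ℝ) (φ : Set (Space l)) : ℝ≥0∞ :=
  ⨆ (x : Space l) (_ : IsServing h φ x), receivedPower h x / interference h φ x

theorem add_interference {l : ℕ} (h : ℝ → ℝ) (φ : Set (Space l)) {x : Space l} (hx : x ∈ φ) :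
    receivedPower h x + interference h φ x = ∑' y : φ, receivedPower h (y : Space l) := by
  have key := ENNReal.summable.tsum_union_disjoint (f := receivedPower h)
    (s := {x}) (t := φ \ {x}) Set.disjoint_sdiff_right ENNReal.summable
  rw [Set.union_sdiff_cancel (Set.singleton_subset_iff.2 hx), tsum_singleton] at key
  exact key.symm

/-- The value of the carrier-to-interference ratio does not depend on which of the strongest base
stations is chosen. -/
theorem ratio_eq {l : ℕ} (h : ℝ → ℝ) (φ : Set (Space l)) {x : Space l} (hx : IsServing h φ x) :
    ratio h φ = receivedPower h x / interference h φ x := by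
  have aux : ∀ y z : Space l, IsServing h φ y → IsServing h φ z →
      interference h φ y ≤ interference h φ z := by
    intro y z hy hz
    have hp : receivedPower h y = receivedPower h z := le_antisymm (hz.2 y hy.1) (hy.2 z hz.1)
    by_cases hyz : y = z
    · rw [hyz]
    by_cases ht : receivedPower h y = ∞
    · have : receivedPower h y ≤ interference h φ z :=
        ENNReal.le_tsum (f := fun w : ↥(φ \ {z}) => receivedPower h (w : Space l)) ⟨y, hy.1, hyz⟩
      rw [ht, top_le_iff] at this
      rw [this]
      exact le_top
    · have e := (add_interference h φ hy.1).trans (add_interference h φ hz.1).symm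
      rw [← hp] at e
      exact ((ENNReal.add_right_inj ht).1 e).le
  refine le_antisymm (iSup₂_le fun y hy => ?_) (le_iSup₂_of_le x hx le_rfl)
  rw [le_antisymm (hy.2 x hx.1) (hx.2 y hy.1) |>.symm, le_antisymm (aux y x hy hx) (aux x y hx hy)]

/-- The carrier-to-interference ratio at the origin as a real random variable. -/
def CI {l : ℕ} {Ω : Type*} (h : ℝ → ℝ) (Φ : Ω → Set (Space l)) (ω : Ω) : ℝ :=
  (ratio h (Φ ω)).toReal

/-- `X` is smaller than `Y` in the usual stochastic order; the two random variables may live on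
different probability spaces. -/
def StochLE {Ω₁ Ω₂ : Type*} [MeasurableSpace Ω₁] [MeasurableSpace Ω₂]
    (X : Ω₁ → ℝ) (P₁ : Measure Ω₁) (Y : Ω₂ → ℝ) (P₂ : Measure Ω₂) : Prop :=
  AEMeasurable X P₁ ∧ AEMeasurable Y P₂ ∧ ∀ x : ℝ, P₁ {ω | x < X ω} ≤ P₂ {ω | x < Y ω}

/-- The reciprocal of the power-law path loss. -/
def powerLaw (ε : ℝ) (r : ℝ) : ℝ := r ^ ε

/-- The reciprocal of the two-slope path loss with breakpoint `1`. -/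
def twoSlope (ε₁ ε₂ : ℝ) (r : ℝ) : ℝ := if r ≤ 1 then r ^ ε₁ else r ^ ε₂

end ShotgunCellular

end

/-! Both inverse path losses are nondecreasing, so in either system the nearest base station `x_S`
serves, and `I/C` is the sum of `h ‖x_S‖ / h ‖x‖` over the other stations. If `h' / h` is
nondecreasing, every term is at most as large for `h'` as for `h`, so on one fixed configuration
`C/I` is at least as large for `h'` (`IsRegular.ratio_le_ratio`). Here the quotient of the two
losses is `max r 1 ^ (ε₂ - ε₁)`, monotone in a direction given by the sign of `ε₂ - ε₁`.

The two systems may live on different probability spaces. A Poisson process has its law determined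
by its intensity (`map_pointMeasure_eq`), and `C/I` is almost surely a measurable functional of the
counting measure (`ratio_eq_ratioOfMeasure`), so the power-law ratio can be moved to the second
space and compared there pointwise.

Almost surely the configuration is regular (`ae_isRegular`): the origin is not a point, there are at
least two points, and the total power is finite by Campbell's formula, as `(1 + ‖x‖) ^ (-δ)` is
integrable for `δ > l`. -/

noncomputable section

namespace ShotgunCellular

/-- The counting measure of a configuration. -/
def pointMeasure {l : ℕ} (φ : Set (Space l)) : Measure (Space l) := Measure.count.restrict φ

/-! ### Counting measures of locally finite sets -/

section Configuration

variable {l : ℕ} {φ : Set (Space l)}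

theorem countable_of_locallyFinite (hφ : ∀ r : ℝ, (φ ∩ Metric.closedBall 0 r).Finite) :
    φ.Countable := by
  have : φ = ⋃ n : ℕ, φ ∩ Metric.closedBall 0 (n : ℝ) := by
    rw [← Set.inter_iUnion, Metric.iUnion_closedBall_nat, Set.inter_univ]
  rw [this]
  exact Set.countable_iUnion fun n => (hφ n).countable

theorem pointMeasure_apply (hφ : φ.Countable) {A : Set (Space l)} (hA : MeasurableSet A) :
    pointMeasure φ A = ((φ ∩ A).encard : ℝ≥0∞) := by
  rw [pointMeasure, Measure.restrict_apply hA, Set.inter_comm,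
    Measure.count_apply (hφ.measurableSet.inter hA)]

theorem lintegral_pointMeasure (hφ : φ.Countable) (f : Space l → ℝ≥0∞) :
    ∫⁻ x, f x ∂pointMeasure φ = ∑' x : φ, f x := by
  rw [pointMeasure, lintegral_countable f hφ]
  simp

end Configuration

/-! ### The law of a Poisson process is determined by its intensity -/

section Law

variable {l : ℕ} {Ω Ω₁ Ω₂ : Type*} [MeasurableSpace Ω] [MeasurableSpace Ω₁] [MeasurableSpace Ω₂]
  {Φ : Ω → Set (Space l)} {Φ₁ : Ω₁ → Set (Space l)} {Φ₂ : Ω₂ → Set (Space l)}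
  {Λ : Measure (Space l)} {P : Measure Ω} {P₁ : Measure Ω₁} {P₂ : Measure Ω₂}

theorem IsPoissonPointProcess.countable (hΦ : IsPoissonPointProcess Φ Λ P) (ω : Ω) :
    (Φ ω).Countable :=
  countable_of_locallyFinite (hΦ.locallyFinite ω)

theorem IsPoissonPointProcess.measurable_pointMeasure (hΦ : IsPoissonPointProcess Φ Λ P) :
    Measurable fun ω => pointMeasure (Φ ω) := by
  refine Measure.measurable_of_measurable_coe _ fun A hA => ?_
  simp_rw [fun ω => pointMeasure_apply (hΦ.countable ω) hA]
  exact measurable_from_top.comp (hΦ.measurable_count A hA)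

/-- The Poisson masses already sum to one, so nothing is left for the value `⊤`: domination on
singletons between two probability measures on a countable space forces equality. -/
theorem IsPoissonPointProcess.map_encard [IsProbabilityMeasure P]
    (hΦ : IsPoissonPointProcess Φ Λ P) {A : Set (Space l)} (hA : MeasurableSet A)
    (hfin : Λ A < ∞) :
    P.map (fun ω => (Φ ω ∩ A).encard) =
      (poissonMeasure (Λ A).toNNReal).map (Nat.cast : ℕ → ℕ∞) := by
  have hm := hΦ.measurable_count A hA
  have hc : Measurable (Nat.cast : ℕ → ℕ∞) := measurable_from_top
  have := Measure.isProbabilityMeasure_map (μ := P) hm.aemeasurable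
  have := Measure.isProbabilityMeasure_map (μ := poissonMeasure (Λ A).toNNReal) hc.aemeasurable
  symm
  refine Measure.eq_of_le_of_measure_univ_eq ?_ (by simp)
  refine Measure.le_iff.2 fun s _ => ?_
  have key : ∀ k : ℕ∞, (poissonMeasure (Λ A).toNNReal).map (Nat.cast : ℕ → ℕ∞) {k} ≤
      P.map (fun ω => (Φ ω ∩ A).encard) {k} := by
    intro k
    rw [Measure.map_apply hc (measurableSet_singleton _),
      Measure.map_apply hm (measurableSet_singleton _)]
    induction k using ENat.recTopCoe with
    | top =>
      have : (Nat.cast : ℕ → ℕ∞) ⁻¹' {⊤} = ∅ := by ext; simp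
      simp [this]
    | coe k =>
      have : (Nat.cast : ℕ → ℕ∞) ⁻¹' {(k : ℕ∞)} = {k} := by ext; simp
      rw [this, ← hΦ.law_count A hA hfin k]
      rfl
  rw [← Measure.tsum_indicator_apply_singleton _ s s.to_countable.measurableSet,
    ← Measure.tsum_indicator_apply_singleton _ s s.to_countable.measurableSet]
  exact ENNReal.tsum_le_tsum fun k => Set.indicator_le_indicator (key k)

theorem IsPoissonPointProcess.lintegral_pointMeasure_of_lt_top [IsProbabilityMeasure P]
    (hΦ : IsPoissonPointProcess Φ Λ P) {A : Set (Space l)} (hA : MeasurableSet A)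
    (hfin : Λ A < ∞) : ∫⁻ ω, pointMeasure (Φ ω) A ∂P = Λ A := by
  simp_rw [fun ω => pointMeasure_apply (hΦ.countable ω) hA]
  have hc : Measurable (Nat.cast : ℕ → ℕ∞) := measurable_from_top
  have ht : Measurable (fun k : ℕ∞ => (k : ℝ≥0∞)) := measurable_from_top
  rw [← lintegral_map (f := fun k : ℕ∞ => (k : ℝ≥0∞)) ht (hΦ.measurable_count A hA),
    hΦ.map_encard hA hfin, lintegral_map ht hc, lintegral_countable']
  set r := (Λ A).toNNReal with hr
  rw [← ENNReal.coe_toNNReal hfin.ne, ← hr, tsum_eq_zero_add' ENNReal.summable]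
  -- With the zero term split off, this shift turns the series for the mean into `r` times the total
  -- mass.
  have step : ∀ n : ℕ, (((n + 1 : ℕ) : ℕ∞) : ℝ≥0∞) * poissonMeasure r {n + 1} =
      r * poissonMeasure r {n} := by
    intro n
    rw [poissonMeasure_singleton, poissonMeasure_singleton, ENat.toENNReal_coe,
      ← ENNReal.ofReal_natCast, ← ENNReal.ofReal_coe_nnreal,
      ← ENNReal.ofReal_mul (by positivity), ← ENNReal.ofReal_mul (by positivity)]
    congr 1
    rw [Nat.factorial_succ]
    push_cast
    field_simp
    ring
  simp only [step, ENNReal.tsum_mul_left]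
  have := (poissonMeasure r).tsum_indicator_apply_singleton Set.univ MeasurableSet.univ
  simp only [Set.indicator_univ, measure_univ] at this
  simp [this]

/-- Campbell's formula in terms of measures; exhausting by balls reaches sets of infinite intensity,
where `law_count` is silent. -/
theorem IsPoissonPointProcess.bind_pointMeasure [IsProbabilityMeasure P] [IsFiniteMeasureOnCompacts Λ]
    (hΦ : IsPoissonPointProcess Φ Λ P) : P.bind (fun ω => pointMeasure (Φ ω)) = Λ := by
  have hm := hΦ.measurable_pointMeasure.aemeasurable (μ := P)
  have hfin : ∀ n : ℕ, Λ (Metric.closedBall 0 (n : ℝ)) < ∞ := fun n =>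
    (isCompact_closedBall _ _).measure_lt_top
  refine Measure.ext fun A hA => ?_
  have hmono : Monotone fun n : ℕ => A ∩ Metric.closedBall 0 (n : ℝ) := fun m n h =>
    Set.inter_subset_inter_right _ (Metric.closedBall_subset_closedBall (by exact_mod_cast h))
  have hU : A = ⋃ n : ℕ, A ∩ Metric.closedBall 0 (n : ℝ) := by
    rw [← Set.inter_iUnion, Metric.iUnion_closedBall_nat, Set.inter_univ]
  rw [hU, hmono.measure_iUnion, hmono.measure_iUnion]
  congr 1
  funext n
  have hB : MeasurableSet (A ∩ Metric.closedBall (0 : Space l) (n : ℝ)) :=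
    hA.inter measurableSet_closedBall
  rw [Measure.bind_apply hB hm, hΦ.lintegral_pointMeasure_of_lt_top hB
    ((measure_mono Set.inter_subset_right).trans_lt (hfin n))]

/-- Continuity from above: distribution functions of counts on sets of infinite intensity are limits
of those on bounded sets. -/
theorem IsPoissonPointProcess.measure_le_eq_iInf [IsFiniteMeasure P]
    (hΦ : IsPoissonPointProcess Φ Λ P) {A : Set (Space l)} (hA : MeasurableSet A) (a : ℝ≥0∞) :
    P ((fun ω => pointMeasure (Φ ω) A) ⁻¹' Set.Iic a) =
      ⨅ n : ℕ, P ((fun ω => pointMeasure (Φ ω) (A ∩ Metric.closedBall 0 (n : ℝ))) ⁻¹'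
        Set.Iic a) := by
  have hmono : Monotone fun n : ℕ => A ∩ Metric.closedBall 0 (n : ℝ) := fun m n h =>
    Set.inter_subset_inter_right _ (Metric.closedBall_subset_closedBall (by exact_mod_cast h))
  have hU : A = ⋃ n : ℕ, A ∩ Metric.closedBall 0 (n : ℝ) := by
    rw [← Set.inter_iUnion, Metric.iUnion_closedBall_nat, Set.inter_univ]
  have anti : Antitone fun n : ℕ =>
      (fun ω => pointMeasure (Φ ω) (A ∩ Metric.closedBall 0 (n : ℝ))) ⁻¹' Set.Iic a :=
    fun m n h ω hω => (measure_mono (hmono h)).trans hω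
  rw [← anti.measure_iInter (fun n => ((Measure.measurable_coe
    (hA.inter measurableSet_closedBall)).comp hΦ.measurable_pointMeasure
      measurableSet_Iic).nullMeasurableSet) ⟨0, measure_ne_top _ _⟩]
  congr 1
  ext ω
  have : pointMeasure (Φ ω) A = ⨆ n : ℕ, pointMeasure (Φ ω) (A ∩ Metric.closedBall 0 (n : ℝ)) := by
    conv_lhs => rw [hU]
    exact hmono.measure_iUnion
  simp [this]

theorem map_pointMeasure_apply_eq [IsProbabilityMeasure P₁] [IsProbabilityMeasure P₂]
    [IsFiniteMeasureOnCompacts Λ]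
    (h₁ : IsPoissonPointProcess Φ₁ Λ P₁) (h₂ : IsPoissonPointProcess Φ₂ Λ P₂)
    {A : Set (Space l)} (hA : MeasurableSet A) :
    P₁.map (fun ω => pointMeasure (Φ₁ ω) A) = P₂.map (fun ω => pointMeasure (Φ₂ ω) A) := by
  have hfin : ∀ n : ℕ, Λ (A ∩ Metric.closedBall 0 (n : ℝ)) < ∞ := fun n =>
    (measure_mono Set.inter_subset_right).trans_lt (isCompact_closedBall _ _).measure_lt_top
  have hB : ∀ n : ℕ, MeasurableSet (A ∩ Metric.closedBall (0 : Space l) (n : ℝ)) := fun n =>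
    hA.inter measurableSet_closedBall
  have ht : Measurable (fun k : ℕ∞ => (k : ℝ≥0∞)) := measurable_from_top
  have m₁ : ∀ {B}, MeasurableSet B → Measurable fun ω => pointMeasure (Φ₁ ω) B := fun h =>
    (Measure.measurable_coe h).comp h₁.measurable_pointMeasure
  have m₂ : ∀ {B}, MeasurableSet B → Measurable fun ω => pointMeasure (Φ₂ ω) B := fun h =>
    (Measure.measurable_coe h).comp h₂.measurable_pointMeasure
  have hbd : ∀ n : ℕ, P₁.map (fun ω => pointMeasure (Φ₁ ω) (A ∩ Metric.closedBall 0 (n : ℝ))) =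
      P₂.map (fun ω => pointMeasure (Φ₂ ω) (A ∩ Metric.closedBall 0 (n : ℝ))) := by
    intro n
    simp_rw [fun ω => pointMeasure_apply (h₁.countable ω) (hB n),
      fun ω => pointMeasure_apply (h₂.countable ω) (hB n)]
    have e₁ := Measure.map_map (μ := P₁) ht (h₁.measurable_count _ (hB n))
    have e₂ := Measure.map_map (μ := P₂) ht (h₂.measurable_count _ (hB n))
    rw [h₁.map_encard (hB n) (hfin n)] at e₁
    rw [h₂.map_encard (hB n) (hfin n)] at e₂
    exact e₁.symm.trans e₂
  have := Measure.isProbabilityMeasure_map (μ := P₁) (m₁ hA).aemeasurable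
  refine Measure.ext_of_Iic _ _ fun a => ?_
  rw [Measure.map_apply (m₁ hA) measurableSet_Iic, Measure.map_apply (m₂ hA) measurableSet_Iic,
    h₁.measure_le_eq_iInf hA, h₂.measure_le_eq_iInf hA]
  congr 1
  funext n
  rw [← Measure.map_apply (m₁ (hB n)) measurableSet_Iic,
    ← Measure.map_apply (m₂ (hB n)) measurableSet_Iic, hbd]

/-- The cell of the partition generated by a finite family of sets which lies inside exactly the
members selected by `c`. -/
def cell {α ι : Type*} (A : ι → Set α) (c : ι → Bool) : Set α := {x | ∀ i, x ∈ A i ↔ c i = true}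

theorem measurableSet_cell {α ι : Type*} [MeasurableSpace α] [Countable ι] {A : ι → Set α}
    (hA : ∀ i, MeasurableSet (A i)) (c : ι → Bool) : MeasurableSet (cell A c) := by
  have : cell A c = ⋂ i, {x | x ∈ A i ↔ c i = true} := by ext; simp [cell]
  rw [this]
  refine MeasurableSet.iInter fun i => ?_
  cases h : c i
  · simp only [Bool.false_eq_true, iff_false]
    exact (hA i).compl
  · simpa using hA i

theorem pairwise_disjoint_cell {α ι : Type*} (A : ι → Set α) :
    Pairwise (Function.onFun Disjoint (cell A)) := by
  intro c d hcd
  refine Set.disjoint_left.2 fun x hx hy => hcd (funext fun i => ?_)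
  exact Bool.eq_iff_iff.2 ((hx i).symm.trans (hy i))

theorem measure_eq_sum_cell {α ι : Type*} [MeasurableSpace α] [Fintype ι] [DecidableEq ι]
    {A : ι → Set α} (hA : ∀ i, MeasurableSet (A i)) (μ : Measure α) (i : ι) :
    μ (A i) = ∑ c : ι → Bool with c i = true, μ (cell A c) := by
  rw [← measure_biUnion_finset (fun c _ d _ h => pairwise_disjoint_cell A h)
    (fun c _ => measurableSet_cell hA c)]
  congr 1
  ext x
  simp only [Set.mem_iUnion, Finset.mem_filter, Finset.mem_univ, true_and, exists_prop]
  classical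
  refine ⟨fun hx => ⟨fun j => decide (x ∈ A j), by simpa using hx, fun j => by simp⟩, ?_⟩
  rintro ⟨c, hc, hx⟩
  exact (hx i).2 hc

theorem IsPoissonPointProcess.map_pointMeasure_eq_pi [IsProbabilityMeasure P]
    (hΦ : IsPoissonPointProcess Φ Λ P) {ι : Type*} [Fintype ι] {A : ι → Set (Space l)}
    (hA : ∀ i, MeasurableSet (A i)) (hd : Pairwise (Function.onFun Disjoint A)) :
    P.map (fun ω i => pointMeasure (Φ ω) (A i)) =
      Measure.pi fun i => P.map fun ω => pointMeasure (Φ ω) (A i) := by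
  have e := Fintype.equivFin ι
  have h := (hΦ.indep_count _ (fun k => A (e.symm k)) (fun k => hA _)
    (fun a b hab => hd (e.symm.injective.ne hab))).precomp e.injective
  simp only [Equiv.symm_apply_apply] at h
  have ht : Measurable (fun k : ℕ∞ => (k : ℝ≥0∞)) := measurable_from_top
  have h' : iIndepFun (fun i ω => pointMeasure (Φ ω) (A i)) P := by
    have := h.comp (fun _ (k : ℕ∞) => (k : ℝ≥0∞)) fun _ => ht
    convert this using 3 with i ω
    exact pointMeasure_apply (hΦ.countable _) (hA _)
  exact (iIndepFun_iff_map_fun_eq_pi_map fun i =>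
    ((Measure.measurable_coe (hA i)).comp hΦ.measurable_pointMeasure).aemeasurable).1 h'

/-- Independence is available only for disjoint sets. The cells generated by the `A i` are disjoint,
so their joint law is a product of known marginals, and each count on `A i` is a sum of cell counts.
-/
theorem map_pointMeasure_pi_eq [IsProbabilityMeasure P₁] [IsProbabilityMeasure P₂]
    [IsFiniteMeasureOnCompacts Λ]
    (h₁ : IsPoissonPointProcess Φ₁ Λ P₁) (h₂ : IsPoissonPointProcess Φ₂ Λ P₂)
    {ι : Type*} [Fintype ι] {A : ι → Set (Space l)} (hA : ∀ i, MeasurableSet (A i)) :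
    P₁.map (fun ω i => pointMeasure (Φ₁ ω) (A i)) =
      P₂.map (fun ω i => pointMeasure (Φ₂ ω) (A i)) := by
  classical
  have hc := measurableSet_cell hA
  have hcell : P₁.map (fun ω c => pointMeasure (Φ₁ ω) (cell A c)) =
      P₂.map (fun ω c => pointMeasure (Φ₂ ω) (cell A c)) := by
    rw [h₁.map_pointMeasure_eq_pi hc (pairwise_disjoint_cell A),
      h₂.map_pointMeasure_eq_pi hc (pairwise_disjoint_cell A)]
    congr 1
    funext c
    exact map_pointMeasure_apply_eq h₁ h₂ (hc c)
  have hs : Measurable fun (v : (ι → Bool) → ℝ≥0∞) (i : ι) =>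
      ∑ c : ι → Bool with c i = true, v c :=
    measurable_pi_iff.2 fun i => Finset.measurable_sum _ fun c _ => measurable_pi_apply c
  have e₁ := Measure.map_map (μ := P₁) hs (measurable_pi_iff.2 fun c =>
    (Measure.measurable_coe (hc c)).comp h₁.measurable_pointMeasure)
  have e₂ := Measure.map_map (μ := P₂) hs (measurable_pi_iff.2 fun c =>
    (Measure.measurable_coe (hc c)).comp h₂.measurable_pointMeasure)
  simp_rw [measure_eq_sum_cell hA]
  exact e₁.symm.trans ((congrArg _ hcell).trans e₂)

/-- The law of a Poisson point process is determined by its intensity measure. -/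
theorem map_pointMeasure_eq [IsProbabilityMeasure P₁] [IsProbabilityMeasure P₂]
    [IsFiniteMeasureOnCompacts Λ]
    (h₁ : IsPoissonPointProcess Φ₁ Λ P₁) (h₂ : IsPoissonPointProcess Φ₂ Λ P₂) :
    P₁.map (fun ω => pointMeasure (Φ₁ ω)) = P₂.map (fun ω => pointMeasure (Φ₂ ω)) := by
  let ev : Measure (Space l) → ({A : Set (Space l) // MeasurableSet A} → ℝ≥0∞) := fun μ A => μ A
  have hev : Measurable ev := measurable_pi_iff.2 fun A => Measure.measurable_coe A.2
  have m₁ := h₁.measurable_pointMeasure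
  have m₂ := h₂.measurable_pointMeasure
  have key : (P₁.map (fun ω => pointMeasure (Φ₁ ω))).map ev =
      (P₂.map (fun ω => pointMeasure (Φ₂ ω))).map ev := by
    have := Measure.isProbabilityMeasure_map (μ := P₁) m₁.aemeasurable
    -- Finite-dimensional marginals determine a law on the product; the projective family is taken
    -- to be the marginals of the first law.
    refine IsProjectiveLimit.unique
      (P := fun I => ((P₁.map (fun ω => pointMeasure (Φ₁ ω))).map ev).map I.restrict)
      (fun I => rfl) (fun I => ?_)
    beta_reduce
    rw [Measure.map_map hev m₁, Measure.map_map hev m₂,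
      Measure.map_map (Finset.measurable_restrict I) (hev.comp m₁)]
    refine (Measure.map_map (Finset.measurable_restrict I) (hev.comp m₂)).trans ?_
    exact (map_pointMeasure_pi_eq h₁ h₂ (A := fun i : I => (i : Set (Space l)))
      fun i => i.1.2).symm
  -- The evaluations generate the σ-algebra on measures, so every event there is a preimage under
  -- `ev`.
  have hle : (Measure.instMeasurableSpace : MeasurableSpace (Measure (Space l))) ≤
      MeasurableSpace.comap ev inferInstance := by
    refine iSup₂_le fun A hA => ?_
    rw [← BorelSpace.measurable_eq (α := ℝ≥0∞)]
    exact ((measurable_pi_apply (⟨A, hA⟩ : {A : Set (Space l) // MeasurableSet A})).comp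
      (comap_measurable ev)).comap_le
  refine Measure.ext fun B hB => ?_
  obtain ⟨C, hC, rfl⟩ := hle B hB
  rw [← Measure.map_apply hev hC, key, Measure.map_apply hev hC]

end Law

/-! ### Measurability of the ratio -/

/-- The carrier-to-interference ratio as a functional of the counting measure. -/
def ratioOfMeasure {l : ℕ} (h : ℝ → ℝ) (μ : Measure (Space l)) : ℝ≥0∞ :=
  essSup (receivedPower h) μ /
    (∫⁻ x, receivedPower h x ∂μ - essSup (receivedPower h) μ)

theorem measurable_receivedPower {l : ℕ} {h : ℝ → ℝ} (hh : Measurable h) :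
    Measurable (receivedPower h : Space l → ℝ≥0∞) :=
  (hh.comp measurable_norm).ennreal_ofReal.inv

/-- The condition `essSup f μ ≤ a` says that `μ` vanishes on `{f > a}`, which is a condition on a
single evaluation of `μ`. -/
theorem measurable_essSup {α : Type*} [MeasurableSpace α] {f : α → ℝ≥0∞} (hf : Measurable f) :
    Measurable fun μ : Measure α => essSup f μ := by
  refine measurable_of_Iic fun a => ?_
  have : (fun μ : Measure α => essSup f μ) ⁻¹' Set.Iic a = {μ | μ {x | a < f x} = 0} := by
    ext μ
    simp only [Set.mem_preimage, Set.mem_Iic, Set.mem_ofPred_eq]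
    constructor
    · intro h
      have := (ENNReal.ae_le_essSup (μ := μ) f).mono fun x hx => hx.trans h
      simpa [ae_iff] using this
    · intro h
      refine essSup_le_of_ae_le a ?_
      rw [Filter.EventuallyLE, ae_iff]
      simpa using h
  rw [this]
  exact Measure.measurable_coe (hf measurableSet_Ioi) (measurableSet_singleton 0)

theorem measurable_ratioOfMeasure {l : ℕ} {h : ℝ → ℝ} (hh : Measurable h) :
    Measurable (ratioOfMeasure h : Measure (Space l) → ℝ≥0∞) := by
  have hp := measurable_receivedPower (l := l) hh
  exact (measurable_essSup hp).div ((Measure.measurable_lintegral hp).sub (measurable_essSup hp))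

/-! ### Regular configurations and the pointwise comparison -/

/-- The inverse path losses of interest: measurable, positive and nondecreasing on `(0, ∞)`. -/
structure IsInversePathLoss (h : ℝ → ℝ) : Prop where
  measurable : Measurable h
  pos : ∀ r, 0 < r → 0 < h r
  mono : MonotoneOn h (Set.Ioi 0)

/-- Configurations in which the carrier-to-interference ratio is well defined, positive and
finite. -/
structure IsRegular {l : ℕ} (h : ℝ → ℝ) (φ : Set (Space l)) : Prop where
  locallyFinite : ∀ r : ℝ, (φ ∩ Metric.closedBall 0 r).Finite
  zero_notMem : (0 : Space l) ∉ φ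
  nontrivial : φ.Nontrivial
  tsum_ne_top : ∑' x : φ, receivedPower h (x : Space l) ≠ ∞

section Configuration

variable {l : ℕ} {h h' : ℝ → ℝ} {φ : Set (Space l)}

theorem receivedPower_lt_top (hh : IsInversePathLoss h) {x : Space l} (hx : x ≠ 0) :
    receivedPower h x < ∞ := by
  simpa [receivedPower] using hh.pos _ (norm_pos_iff.2 hx)

theorem receivedPower_pos (h : ℝ → ℝ) (x : Space l) : 0 < receivedPower h x := by
  simp [receivedPower]

namespace IsRegular

theorem ne_zero (hφ : IsRegular h φ) {x : Space l} (hx : x ∈ φ) : x ≠ 0 :=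
  fun e => hφ.zero_notMem (e ▸ hx)

theorem norm_pos (hφ : IsRegular h φ) {x : Space l} (hx : x ∈ φ) : 0 < ‖x‖ :=
  norm_pos_iff.2 (hφ.ne_zero hx)

theorem exists_nearest (hφ : IsRegular h φ) : ∃ x ∈ φ, ∀ y ∈ φ, ‖x‖ ≤ ‖y‖ := by
  obtain ⟨z, hz⟩ := hφ.nontrivial.nonempty
  obtain ⟨x, ⟨hx, hxz⟩, hmin⟩ := Set.exists_min_image _ (fun x : Space l => ‖x‖)
    (hφ.locallyFinite ‖z‖) ⟨z, hz, by simp⟩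
  rw [mem_closedBall_zero_iff] at hxz
  refine ⟨x, hx, fun y hy => ?_⟩
  by_cases hyz : ‖y‖ ≤ ‖z‖
  · exact hmin y ⟨hy, by simpa using hyz⟩
  · exact hxz.trans (not_le.1 hyz).le

theorem isServing (hφ : IsRegular h φ) (hh : IsInversePathLoss h') {x : Space l} (hx : x ∈ φ)
    (hmin : ∀ y ∈ φ, ‖x‖ ≤ ‖y‖) : IsServing h' φ x :=
  ⟨hx, fun y hy => ENNReal.inv_le_inv.2 (ENNReal.ofReal_le_ofReal
    (hh.mono (hφ.norm_pos hx) (hφ.norm_pos hy) (hmin y hy)))⟩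

theorem interference_pos (hφ : IsRegular h φ) (h' : ℝ → ℝ) (x : Space l) :
    0 < interference h' φ x := by
  obtain ⟨y, hy, hyx⟩ := hφ.nontrivial.exists_ne x
  exact (receivedPower_pos h' y).trans_le
    (ENNReal.le_tsum (f := fun w : ↥(φ \ {x}) => receivedPower h' (w : Space l)) ⟨y, hy, hyx⟩)

theorem interference_ne_top (hφ : IsRegular h φ) {x : Space l} (hx : x ∈ φ) :
    interference h φ x ≠ ∞ := by
  have := add_interference h φ hx
  exact ne_top_of_le_ne_top hφ.tsum_ne_top (this ▸ le_add_self)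

theorem ratio_pos (hφ : IsRegular h φ) (hh : IsInversePathLoss h) : 0 < ratio h φ := by
  obtain ⟨x, hx, hmin⟩ := hφ.exists_nearest
  rw [ratio_eq h φ (hφ.isServing hh hx hmin)]
  exact ENNReal.div_pos (receivedPower_pos h x).ne' (hφ.interference_ne_top hx)

theorem ratio_lt_top (hφ : IsRegular h φ) (hh : IsInversePathLoss h) : ratio h φ < ∞ := by
  obtain ⟨x, hx, hmin⟩ := hφ.exists_nearest
  rw [ratio_eq h φ (hφ.isServing hh hx hmin)]
  exact ENNReal.div_lt_top (receivedPower_lt_top hh (hφ.ne_zero hx)).ne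
    (hφ.interference_pos h x).ne'

theorem ratio_eq_ratioOfMeasure (hφ : IsRegular h φ) (hh : IsInversePathLoss h) :
    ratio h φ = ratioOfMeasure h (pointMeasure φ) := by
  obtain ⟨x, hx, hmin⟩ := hφ.exists_nearest
  have hs := hφ.isServing hh hx hmin
  have hc := countable_of_locallyFinite hφ.locallyFinite
  have hsup : essSup (receivedPower h) (pointMeasure φ) = receivedPower h x := by
    refine le_antisymm (essSup_le_of_ae_le _ ?_) ?_
    · exact (ae_restrict_iff' hc.measurableSet).2 (Filter.Eventually.of_forall hs.2)
    -- A strictly smaller essential supremum would make `{x}` null, yet it carries mass one.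
    · by_contra! hlt
      have h0 := ae_lt_of_essSup_lt hlt
      rw [ae_iff] at h0
      have h1 : pointMeasure φ {x} = 0 :=
        measure_mono_null (Set.singleton_subset_iff.2 (by simp)) h0
      rw [pointMeasure_apply hc (measurableSet_singleton x),
        Set.inter_eq_right.2 (Set.singleton_subset_iff.2 hx)] at h1
      simp at h1
  rw [ratio_eq h φ hs, ratioOfMeasure, hsup, lintegral_pointMeasure hc,
    ← add_interference h φ hx,
    ENNReal.add_sub_cancel_left (receivedPower_lt_top hh (hφ.ne_zero hx)).ne]

/-- If `h' / h` is nondecreasing then path loss `1 / h'` gives the larger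
carrier-to-interference ratio. -/
theorem ratio_le_ratio (hφ : IsRegular h φ) (hh : IsInversePathLoss h)
    (hh' : IsInversePathLoss h')
    (hle : ∀ r s, 0 < r → r ≤ s → h s * h' r ≤ h' s * h r) :
    ratio h φ ≤ ratio h' φ := by
  obtain ⟨x, hx, hmin⟩ := hφ.exists_nearest
  rw [ratio_eq h φ (hφ.isServing hh hx hmin), ratio_eq h' φ (hφ.isServing hh' hx hmin)]
  have hx0 := hφ.norm_pos hx
  -- The termwise comparison of `I/C`, cross-multiplied to avoid division.
  have key : ∀ y ∈ φ, receivedPower h' y * receivedPower h x ≤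
      receivedPower h' x * receivedPower h y := by
    intro y hy
    have hy0 := hφ.norm_pos hy
    have p := hh.pos _ hx0
    have p' := hh'.pos _ hx0
    have q := hh.pos _ hy0
    have q' := hh'.pos _ hy0
    simp only [receivedPower]
    rw [← ENNReal.mul_inv (by simp) (by simp), ← ENNReal.mul_inv (by simp) (by simp),
      ENNReal.inv_le_inv, ← ENNReal.ofReal_mul p'.le, ← ENNReal.ofReal_mul q'.le]
    refine ENNReal.ofReal_le_ofReal ?_
    rw [mul_comm]
    exact hle _ _ hx0 (hmin y hy)
  have hI : interference h' φ x * receivedPower h x ≤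
      receivedPower h' x * interference h φ x := by
    rw [interference, interference, ← ENNReal.tsum_mul_left, ← ENNReal.tsum_mul_right]
    exact ENNReal.tsum_le_tsum fun y => key y y.2.1
  have hi0 := (hφ.interference_pos h x).ne'
  have hit := hφ.interference_ne_top hx
  have hx't := (receivedPower_lt_top hh' (hφ.ne_zero hx)).ne
  have hx't0 := (receivedPower_pos h' x).ne'
  rw [ENNReal.div_le_iff hi0 hit]
  -- Regularity is assumed for `h` only; finiteness for `h'` follows from `hI`.
  have hi't : interference h' φ x ≠ ∞ := by
    intro e
    rw [e, ENNReal.top_mul (receivedPower_pos h x).ne', top_le_iff] at hI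
    exact ENNReal.mul_ne_top hx't hit hI
  rw [div_eq_mul_inv, mul_right_comm, ← div_eq_mul_inv,
    ENNReal.le_div_iff_mul_le (Or.inl (hφ.interference_pos h' x).ne') (Or.inl hi't), mul_comm]
  exact hI

end IsRegular

/-- The factor `2 ^ δ` comes from `1 + ‖x‖ ≤ 2 * ‖x‖`; the bound has no singularity at the origin
and is integrable for `δ > l`. -/
theorem receivedPower_le_of_rpow_le {δ : ℝ} (hδ : 0 ≤ δ) (hdecay : ∀ r, 1 < r → r ^ δ ≤ h r)
    {x : Space l} (hx : 1 < ‖x‖) :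
    receivedPower h x ≤ ENNReal.ofReal (2 ^ δ) * ENNReal.ofReal ((1 + ‖x‖) ^ (-δ)) := by
  have hx0 : 0 < ‖x‖ := by linarith
  rw [receivedPower, ← ENNReal.ofReal_mul (by positivity),
    ← ENNReal.ofReal_inv_of_pos ((Real.rpow_pos_of_pos hx0 δ).trans_le (hdecay _ hx))]
  refine ENNReal.ofReal_le_ofReal ?_
  calc (h ‖x‖)⁻¹ ≤ (‖x‖ ^ δ)⁻¹ := inv_anti₀ (by positivity) (hdecay _ hx)
    _ = 2 ^ δ * ((2 * ‖x‖) ^ δ)⁻¹ := by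
      rw [Real.mul_rpow (by norm_num) hx0.le]
      field_simp
    _ ≤ 2 ^ δ * ((1 + ‖x‖) ^ δ)⁻¹ := by
      gcongr
      linarith
    _ = 2 ^ δ * (1 + ‖x‖) ^ (-δ) := by rw [Real.rpow_neg (by positivity)]

end Configuration

/-! ### Almost sure regularity and transfer between probability spaces -/

section AlmostSure

variable {l : ℕ} {Ω Ω₁ Ω₂ : Type*} [MeasurableSpace Ω] [MeasurableSpace Ω₁] [MeasurableSpace Ω₂]
  {Φ : Ω → Set (Space l)} {Φ₁ : Ω₁ → Set (Space l)} {Φ₂ : Ω₂ → Set (Space l)}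
  {Λ : Measure (Space l)} {P : Measure Ω} {P₁ : Measure Ω₁} {P₂ : Measure Ω₂}

theorem IsPoissonPointProcess.ae_zero_notMem [IsProbabilityMeasure P]
    (hΦ : IsPoissonPointProcess Φ Λ P) (h0 : Λ {0} = 0) : ∀ᵐ ω ∂P, (0 : Space l) ∉ Φ ω := by
  have hm := measurableSet_singleton (0 : Space l)
  have e := hΦ.lintegral_pointMeasure_of_lt_top hm (by simp [h0])
  have hmeas : Measurable fun ω => pointMeasure (Φ ω) {0} :=
    (Measure.measurable_coe hm).comp hΦ.measurable_pointMeasure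
  rw [h0, lintegral_eq_zero_iff hmeas] at e
  filter_upwards [e] with ω hω hmem
  rw [pointMeasure_apply (hΦ.countable ω) hm,
    Set.inter_eq_right.2 (Set.singleton_subset_iff.2 hmem)] at hω
  simp at hω

/-- A configuration with at most one point has count 0 or 1 in every ball, and both Poisson
probabilities tend to zero as the mean grows to infinity. -/
theorem IsPoissonPointProcess.ae_nontrivial [IsFiniteMeasureOnCompacts Λ]
    (hΦ : IsPoissonPointProcess Φ Λ P) (hΛ : Λ Set.univ = ∞) : ∀ᵐ ω ∂P, (Φ ω).Nontrivial := by
  have hmono : Monotone fun n : ℕ => Metric.closedBall (0 : Space l) (n : ℝ) := fun m n h =>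
    Metric.closedBall_subset_closedBall (by exact_mod_cast h)
  have hfin : ∀ n : ℕ, Λ (Metric.closedBall 0 (n : ℝ)) < ∞ := fun n =>
    (isCompact_closedBall _ _).measure_lt_top
  have hv : Filter.Tendsto (fun n : ℕ => (Λ (Metric.closedBall 0 (n : ℝ))).toReal)
      Filter.atTop Filter.atTop := by
    have := tendsto_measure_iUnion_atTop (μ := Λ) hmono
    rw [Metric.iUnion_closedBall_nat, hΛ] at this
    rw [← ENNReal.tendsto_ofReal_nhds_top]
    simpa [ENNReal.ofReal_toReal (hfin _).ne, Function.comp_def] using this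
  have hlim : ∀ k : ℕ, Filter.Tendsto
      (fun n : ℕ => P {ω | (Φ ω ∩ Metric.closedBall 0 (n : ℝ)).encard = k})
      Filter.atTop (nhds 0) := by
    intro k
    simp_rw [fun n : ℕ => hΦ.law_count _ measurableSet_closedBall (hfin n) k,
      poissonMeasure_singleton]
    rw [← ENNReal.ofReal_zero]
    refine ENNReal.tendsto_ofReal ?_
    have := ((Real.tendsto_pow_mul_exp_neg_atTop_nhds_zero k).comp hv).div_const (k.factorial : ℝ)
    rw [zero_div] at this
    refine this.congr fun n => ?_
    simp [mul_comm, ENNReal.toReal]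
  rw [ae_iff, ← nonpos_iff_eq_zero]
  have hadd := (hlim 0).add (hlim 1)
  rw [add_zero] at hadd
  refine ge_of_tendsto' hadd fun n => (measure_mono fun ω hω => ?_).trans (measure_union_le _ _)
  have hsub := (Set.not_nontrivial_iff.1 hω).anti
    (Set.inter_subset_left (t := Metric.closedBall (0 : Space l) (n : ℝ)))
  rcases Order.le_one_iff.1 (Set.encard_le_one_iff_subsingleton.2 hsub) with e | e
  · exact Or.inl (by simpa using e)
  · exact Or.inr (by simpa using e)

theorem IsPoissonPointProcess.ae_tsum_ne_top [IsProbabilityMeasure P] [IsFiniteMeasureOnCompacts Λ]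
    (hΦ : IsPoissonPointProcess Φ Λ P) {f : Space l → ℝ≥0∞} (hf : Measurable f)
    (hfin : ∫⁻ x, f x ∂Λ ≠ ∞) : ∀ᵐ ω ∂P, ∑' x : Φ ω, f x ≠ ∞ := by
  have hm := hΦ.measurable_pointMeasure
  rw [← hΦ.bind_pointMeasure, Measure.lintegral_bind hm.aemeasurable hf.aemeasurable] at hfin
  filter_upwards [ae_lt_top ((Measure.measurable_lintegral hf).comp hm) hfin] with ω hω
  rw [← lintegral_pointMeasure (hΦ.countable ω)]
  exact hω.ne

instance isFiniteMeasureOnCompacts_smul_volume (lam : ℝ) :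
    IsFiniteMeasureOnCompacts (ENNReal.ofReal lam • (volume : Measure (Space l))) :=
  ⟨fun K hK => by simpa using ENNReal.mul_lt_top ENNReal.ofReal_lt_top hK.measure_lt_top⟩

theorem IsHomogeneousSCS.ae_isRegular [IsProbabilityMeasure P] (hl : 1 ≤ l) {lam : ℝ}
    (hlam : 0 < lam) (hΦ : IsHomogeneousSCS Φ lam P) {h : ℝ → ℝ} (hh : IsInversePathLoss h)
    {δ : ℝ} (hδ : (l : ℝ) < δ) (hdecay : ∀ r, 1 < r → r ^ δ ≤ h r) :
    ∀ᵐ ω ∂P, IsRegular h (Φ ω) := by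
  -- Positive dimension makes the origin a null set and the total volume infinite.
  have : Nonempty (Fin l) := ⟨⟨0, hl⟩⟩
  have hδ0 : 0 ≤ δ := (Nat.cast_nonneg l).trans hδ.le
  have hlam' : ENNReal.ofReal lam ≠ 0 := by simpa using hlam
  have hP : IsPoissonPointProcess Φ _ P := hΦ
  let f : Space l → ℝ≥0∞ := fun x =>
    ENNReal.ofReal (2 ^ δ) * ENNReal.ofReal ((1 + ‖x‖) ^ (-δ))
  have hf : Measurable f := by
    refine Measurable.const_mul (Measurable.ennreal_ofReal ?_) _
    fun_prop
  have hint : ∫⁻ x, f x ∂(ENNReal.ofReal lam • (volume : Measure (Space l))) ≠ ∞ := by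
    rw [lintegral_smul_measure, lintegral_const_mul' _ _ ENNReal.ofReal_ne_top, smul_eq_mul]
    exact ENNReal.mul_ne_top ENNReal.ofReal_ne_top (ENNReal.mul_ne_top ENNReal.ofReal_ne_top
      (finite_integral_one_add_norm (by simpa using hδ)).ne)
  filter_upwards [hP.ae_zero_notMem (by simp), hP.ae_nontrivial (by
    simp [measure_univ_of_isAddLeftInvariant, hlam]), hP.ae_tsum_ne_top hf hint] with ω h0 h2 hs
  refine ⟨hP.locallyFinite ω, h0, h2, ?_⟩
  -- The decay bound holds only outside the unit ball; inside there are finitely many points, each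
  -- of finite power.
  set B := Metric.closedBall (0 : Space l) 1
  have hsplit := ENNReal.tsum_union_le (receivedPower h) (Φ ω ∩ B) (Φ ω \ B)
  rw [Set.inter_union_sdiff] at hsplit
  refine ne_top_of_le_ne_top (ENNReal.add_ne_top.2 ⟨?_, ?_⟩) hsplit
  · have := (hP.locallyFinite ω 1).fintype
    rw [tsum_fintype]
    exact (ENNReal.sum_lt_top.2 fun x _ => receivedPower_lt_top hh
      fun e => h0 (e ▸ x.2.1)).ne
  · refine ne_top_of_le_ne_top hs ?_
    refine (ENNReal.tsum_le_tsum (g := fun x : ↥(Φ ω \ B) => f x) fun x =>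
      receivedPower_le_of_rpow_le hδ0 hdecay ?_).trans
        (ENNReal.tsum_mono_subtype f Set.sdiff_subset)
    simpa [B] using x.2.2

theorem CI_ae_eq {h : ℝ → ℝ} (hh : IsInversePathLoss h) (hreg : ∀ᵐ ω ∂P, IsRegular h (Φ ω)) :
    CI h Φ =ᵐ[P] fun ω => (ratioOfMeasure h (pointMeasure (Φ ω))).toReal := by
  filter_upwards [hreg] with ω hω
  rw [CI, hω.ratio_eq_ratioOfMeasure hh]

theorem IsPoissonPointProcess.aemeasurable_CI (hΦ : IsPoissonPointProcess Φ Λ P) {h : ℝ → ℝ}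
    (hh : IsInversePathLoss h) (hreg : ∀ᵐ ω ∂P, IsRegular h (Φ ω)) :
    AEMeasurable (CI h Φ) P :=
  ⟨_, ((measurable_ratioOfMeasure hh.measurable).comp hΦ.measurable_pointMeasure).ennreal_toReal,
    CI_ae_eq hh hreg⟩

theorem measure_lt_CI_eq [IsProbabilityMeasure P₁] [IsProbabilityMeasure P₂]
    [IsFiniteMeasureOnCompacts Λ]
    (h₁ : IsPoissonPointProcess Φ₁ Λ P₁) (h₂ : IsPoissonPointProcess Φ₂ Λ P₂) {h : ℝ → ℝ}
    (hh : IsInversePathLoss h) (hreg₁ : ∀ᵐ ω ∂P₁, IsRegular h (Φ₁ ω))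
    (hreg₂ : ∀ᵐ ω ∂P₂, IsRegular h (Φ₂ ω)) (t : ℝ) :
    P₁ {ω | t < CI h Φ₁ ω} = P₂ {ω | t < CI h Φ₂ ω} := by
  let S : Set (Measure (Space l)) := {μ | t < (ratioOfMeasure h μ).toReal}
  have hS : MeasurableSet S :=
    (measurable_ratioOfMeasure hh.measurable).ennreal_toReal measurableSet_Ioi
  have e₁ : P₁ {ω | t < CI h Φ₁ ω} = P₁ ((fun ω => pointMeasure (Φ₁ ω)) ⁻¹' S) :=
    measure_congr ((CI_ae_eq hh hreg₁).mono fun ω hω =>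
      propext (iff_of_eq (congrArg (fun z : ℝ => t < z) hω)))
  have e₂ : P₂ {ω | t < CI h Φ₂ ω} = P₂ ((fun ω => pointMeasure (Φ₂ ω)) ⁻¹' S) :=
    measure_congr ((CI_ae_eq hh hreg₂).mono fun ω hω =>
      propext (iff_of_eq (congrArg (fun z : ℝ => t < z) hω)))
  rw [e₁, e₂, ← Measure.map_apply h₁.measurable_pointMeasure hS,
    ← Measure.map_apply h₂.measurable_pointMeasure hS, map_pointMeasure_eq h₁ h₂]

theorem measure_lt_CI_le {h h' : ℝ → ℝ} (hh : IsInversePathLoss h) (hh' : IsInversePathLoss h')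
    (hreg : ∀ᵐ ω ∂P, IsRegular h (Φ ω)) (hreg' : ∀ᵐ ω ∂P, IsRegular h' (Φ ω))
    (hle : ∀ r s, 0 < r → r ≤ s → h s * h' r ≤ h' s * h r) (t : ℝ) :
    P {ω | t < CI h Φ ω} ≤ P {ω | t < CI h' Φ ω} := by
  refine measure_mono_ae ?_
  filter_upwards [hreg, hreg'] with ω hω hω' ht
  -- Finiteness of the larger ratio matters because `toReal` sends `∞` to `0`.
  exact lt_of_lt_of_le ht (ENNReal.toReal_mono (hω'.ratio_lt_top hh').ne
    (hω.ratio_le_ratio hh hh' hle))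

end AlmostSure

/-! ### The two path losses and their quotient -/

section PathLoss

theorem isInversePathLoss_powerLaw {ε : ℝ} (hε : 0 < ε) : IsInversePathLoss (powerLaw ε) where
  measurable := by unfold powerLaw; fun_prop
  pos r hr := Real.rpow_pos_of_pos hr ε
  mono r hr s _ hrs := Real.rpow_le_rpow (le_of_lt hr) hrs hε.le

theorem isInversePathLoss_twoSlope {ε₁ ε₂ : ℝ} (hε₁ : 0 < ε₁) (hε₂ : 0 < ε₂) :
    IsInversePathLoss (twoSlope ε₁ ε₂) where
  measurable := by
    unfold twoSlope
    exact Measurable.ite measurableSet_Iic (by fun_prop) (by fun_prop)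
  pos r hr := by
    unfold twoSlope
    split_ifs
    exacts [Real.rpow_pos_of_pos hr _, Real.rpow_pos_of_pos hr _]
  mono r hr s _ hrs := by
    have hr : 0 < r := hr
    unfold twoSlope
    split_ifs with h1 h2 h2
    · exact Real.rpow_le_rpow hr.le hrs hε₁.le
    · exact (Real.rpow_le_one hr.le h1 hε₁.le).trans
        (Real.one_le_rpow (not_le.1 h2).le hε₂.le)
    · exact absurd (hrs.trans h2) h1
    · exact Real.rpow_le_rpow hr.le hrs hε₂.le

theorem twoSlope_eq_powerLaw_mul {ε₁ ε₂ r : ℝ} (hr : 0 < r) :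
    twoSlope ε₁ ε₂ r = powerLaw ε₁ r * max r 1 ^ (ε₂ - ε₁) := by
  unfold twoSlope powerLaw
  split_ifs with h
  · simp [max_eq_right h]
  · rw [max_eq_left (not_le.1 h).le, ← Real.rpow_add hr]
    congr 1
    ring

theorem powerLaw_mul_twoSlope_le {ε₁ ε₂ : ℝ} (h : ε₁ ≤ ε₂) {r s : ℝ} (hr : 0 < r) (hrs : r ≤ s) :
    powerLaw ε₁ s * twoSlope ε₁ ε₂ r ≤ twoSlope ε₁ ε₂ s * powerLaw ε₁ r := by
  have hs : 0 < s := hr.trans_le hrs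
  rw [twoSlope_eq_powerLaw_mul hr, twoSlope_eq_powerLaw_mul hs, mul_right_comm, ← mul_assoc]
  have h1 : 0 < powerLaw ε₁ r := Real.rpow_pos_of_pos hr _
  have h2 : 0 < powerLaw ε₁ s := Real.rpow_pos_of_pos hs _
  refine mul_le_mul_of_nonneg_left (Real.rpow_le_rpow (by positivity)
    (max_le_max_right 1 hrs) (sub_nonneg.2 h)) (by positivity)

theorem twoSlope_mul_powerLaw_le {ε₁ ε₂ : ℝ} (h : ε₂ ≤ ε₁) {r s : ℝ} (hr : 0 < r) (hrs : r ≤ s) :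
    twoSlope ε₁ ε₂ s * powerLaw ε₁ r ≤ powerLaw ε₁ s * twoSlope ε₁ ε₂ r := by
  have hs : 0 < s := hr.trans_le hrs
  rw [twoSlope_eq_powerLaw_mul hr, twoSlope_eq_powerLaw_mul hs, mul_right_comm, ← mul_assoc]
  have h1 : 0 < powerLaw ε₁ r := Real.rpow_pos_of_pos hr _
  have h2 : 0 < powerLaw ε₁ s := Real.rpow_pos_of_pos hs _
  refine mul_le_mul_of_nonneg_left (Real.rpow_le_rpow_of_nonpos (by positivity)
    (max_le_max_right 1 hrs) (sub_nonpos.2 h)) (by positivity)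

end PathLoss

end ShotgunCellular

end

theorem mainTheorem8 (l : ℕ) (hl : 1 ≤ l) (lam : ℝ) (hlam : 0 < lam)
    (ε₁ ε₂ : ℝ) (hε₁ : (l : ℝ) < ε₁) (hε₂ : (l : ℝ) < ε₂)
    {Ω₁ Ω₂ : Type*} [MeasurableSpace Ω₁] [MeasurableSpace Ω₂]
    (P₁ : Measure Ω₁) [IsProbabilityMeasure P₁] (P₂ : Measure Ω₂) [IsProbabilityMeasure P₂]
    (Φ₁ : Ω₁ → Set (ShotgunCellular.Space l)) (Φ₂ : Ω₂ → Set (ShotgunCellular.Space l))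
    (hΦ₁ : ShotgunCellular.IsHomogeneousSCS Φ₁ lam P₁)
    (hΦ₂ : ShotgunCellular.IsHomogeneousSCS Φ₂ lam P₂) :
    (∀ᵐ ω ∂P₁, 0 < ShotgunCellular.ratio (ShotgunCellular.powerLaw ε₁) (Φ₁ ω) ∧
      ShotgunCellular.ratio (ShotgunCellular.powerLaw ε₁) (Φ₁ ω) < ∞) ∧
    (∀ᵐ ω ∂P₂, 0 < ShotgunCellular.ratio (ShotgunCellular.twoSlope ε₁ ε₂) (Φ₂ ω) ∧
      ShotgunCellular.ratio (ShotgunCellular.twoSlope ε₁ ε₂) (Φ₂ ω) < ∞) ∧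
    (ε₁ < ε₂ →
      ShotgunCellular.StochLE
        (ShotgunCellular.CI (ShotgunCellular.powerLaw ε₁) Φ₁) P₁
        (ShotgunCellular.CI (ShotgunCellular.twoSlope ε₁ ε₂) Φ₂) P₂) ∧
    (ε₂ < ε₁ →
      ShotgunCellular.StochLE
        (ShotgunCellular.CI (ShotgunCellular.twoSlope ε₁ ε₂) Φ₂) P₂
        (ShotgunCellular.CI (ShotgunCellular.powerLaw ε₁) Φ₁) P₁) := by
  have hl0 : (0 : ℝ) ≤ l := Nat.cast_nonneg l
  have hp := ShotgunCellular.isInversePathLoss_powerLaw (hl0.trans_lt hε₁)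
  have ht := ShotgunCellular.isInversePathLoss_twoSlope (hl0.trans_lt hε₁) (hl0.trans_lt hε₂)
  have dp : ∀ r : ℝ, 1 < r → r ^ ε₁ ≤ ShotgunCellular.powerLaw ε₁ r := fun r _ => le_rfl
  have dt : ∀ r : ℝ, 1 < r → r ^ ε₂ ≤ ShotgunCellular.twoSlope ε₁ ε₂ r := fun r hr => by
    rw [ShotgunCellular.twoSlope, if_neg (not_le.2 hr)]
  have rp₁ := hΦ₁.ae_isRegular hl hlam hp hε₁ dp
  -- Both path losses are needed on `Φ₂`, where the pointwise comparison takes place.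
  have rp₂ := hΦ₂.ae_isRegular hl hlam hp hε₁ dp
  have rt₂ := hΦ₂.ae_isRegular hl hlam ht hε₂ dt
  have heq := ShotgunCellular.measure_lt_CI_eq hΦ₁ hΦ₂ hp rp₁ rp₂
  have mp := ShotgunCellular.IsPoissonPointProcess.aemeasurable_CI hΦ₁ hp rp₁
  have mt := ShotgunCellular.IsPoissonPointProcess.aemeasurable_CI hΦ₂ ht rt₂
  refine ⟨rp₁.mono fun ω hω => ⟨hω.ratio_pos hp, hω.ratio_lt_top hp⟩,
    rt₂.mono fun ω hω => ⟨hω.ratio_pos ht, hω.ratio_lt_top ht⟩,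
    fun h => ⟨mp, mt, fun t => ?_⟩, fun h => ⟨mt, mp, fun t => ?_⟩⟩
  · rw [heq t]
    exact ShotgunCellular.measure_lt_CI_le hp ht rp₂ rt₂
      (fun r s hr hrs => ShotgunCellular.powerLaw_mul_twoSlope_le h.le hr hrs) t
  · rw [heq t]
    exact ShotgunCellular.measure_lt_CI_le ht hp rt₂ rp₂
      (fun r s hr hrs => ShotgunCellular.twoSlope_mul_powerLaw_le h.le hr hrs) t
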